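/- Let $(\mathcal X,d)$ be a Polish metric space with its Borel $\sigma$-algebra, let $\lambda>0$, and let $\mathcal P(\mathcal X)$ be the set of Borel probability measures on $\mathcal X$. For $\mu,\nu\in\mathcal P(\mathcal X)$ let $$W^{(\lambda)}(\mu,\nu)=\inf_{\pi\in\Pi(\mu,\nu)}\int_{\mathcal X\times\mathcal X}\min\{d(x,y),2\lambda\}\,d\pi(x,y),$$ where $\Pi(\mu,\nu)$ is the set of couplings of $\mu$ and $\nu$. Let $X_1,X_2,\dots$ be $\mathcal X$-valued random variables on a probability space $(\Omega,\mathcal F,\mathrm P)$, with empirical measures $\hat\mu_n(\omega)=n^{-1}\sum_{i=1}^n\delta_{X_i(\omega)}$, and let $\mu_\star\in\mathcal P(\mathcal X)$. Let the parameter space $(\Theta,\rho_\Theta)$ be a non-empty metric space whose closed bounded subsets are compact (for example a closed subset of $\mathbb R^{d_\theta}$ with the Euclidean distance), and let $\{\mu_\theta\}_{\theta\in\Theta}\subset\mathcal P(\mathcal X)$. Assume: 1. $W^{(\lambda)}(\hat\mu_n,\mu_\star)\to0$ $\mathrm P$-almost surely as $n\to\infty$; 2. $\rho_\Theta(\theta_n,\theta)\to0$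 implies that $\mu_{\theta_n}$ converges weakly to $\mu_\theta$; 3. for some $\varepsilon>0$ the set $\{\theta\in\Theta: W^{(\lambda)}(\mu_\star,\mu_\theta)\le\varepsilon_\star+\varepsilon\}$ is bounded, where $\varepsilon_\star=\inf_{\theta\in\Theta}W^{(\lambda)}(\mu_\star,\mu_\theta)$. Then there is a measurable set $\mathcal A\subset\Omega$ with $\mathrm P(\mathcal A)=1$ such that, for all $\omega\in\mathcal A$, $$\inf_{\theta\in\Theta}W^{(\lambda)}(\hat\mu_n(\omega),\mu_\theta)\to\inf_{\theta\in\Theta}W^{(\lambda)}(\mu_\star,\mu_\theta)\quad(n\to\infty),$$ and there is $n(\omega)$ such that for all $n\ge n(\omega)$ the sets $\operatorname{argmin}_{\theta\in\Theta}W^{(\lambda)}(\hat\mu_n(\omega),\mu_\theta)$ are non-empty, and the union of these sets over $n\ge n(\omega)$ is bounded; moreover $$\limsup_{n\to\infty}\ \operatorname*{argmin}_{\theta\in\Theta}W^{(\lambda)}(\hat\mu_n(\omega),\mu_\theta)\subset\operatorname*{argmin}_{\theta\in\Theta}W^{(\lambda)}(\mu_\star,\mu_\theta),$$ where the $\limsup$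 of a sequence of sets $A_n\subset\Theta$ is the set of all limits of sequences $\theta_k\in A_{n_k}$ along subsequences $n_1<n_2<\cdots$. -/

import Mathlib

open Filter Topology MeasureTheory

noncomputable section

namespace RobustWasserstein

/-- The trimmed cost `c_lam (x, y) = min {d(x, y), 2 lam}`. -/
def trimmedDist {X : Type*} [MetricSpace X] (lam : ℝ) (x y : X) : ℝ :=
  min (dist x y) (2 * lam)

/-- The set `Π(μ, ν)` of couplings: joint measures on `X × X` with first marginal `μ` and
second marginal `ν`. -/
def couplings {X : Type*} [MeasurableSpace X] (μ ν : Measure X) : Set (Measure (X × X)) :=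
  {π | π.fst = μ ∧ π.snd = ν}

/-- The robust Wasserstein distance: the infimum over all couplings of the integral of the
trimmed cost. It is used for probability measures, for which the set of couplings is non-empty
and the (bounded, continuous) cost is integrable. -/
def robustDist {X : Type*} [MetricSpace X] [MeasurableSpace X] (lam : ℝ)
    (μ ν : Measure X) : ℝ :=
  sInf ((fun π : Measure (X × X) => ∫ z, trimmedDist lam z.1 z.2 ∂π) '' couplings μ ν)

/-- The empirical measure of the first `n` observations (a probability measure for `1 ≤ n`). -/
def empirical {Ω X : Type*} [MeasurableSpace X] (Z : ℕ → Ω → X) (n : ℕ) (ω : Ω) : Measure X :=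
  (n : ENNReal)⁻¹ • ∑ i ∈ Finset.range n, Measure.dirac (Z i ω)

/-- The set of global minimizers of `f`. -/
def argminSet {T : Type*} (f : T → ℝ) : Set T :=
  {t | ∀ s, f t ≤ f s}

/-- The limsup (outer limit, in the Painlevé–Kuratowski sense) of a sequence of sets: all limits
of points chosen from the sets along some subsequence. -/
def outerLimit {T : Type*} [TopologicalSpace T] (A : ℕ → Set T) : Set T :=
  {t | ∃ φ : ℕ → ℕ, StrictMono φ ∧
    ∃ u : ℕ → T, (∀ k, u k ∈ A (φ k)) ∧ Tendsto u atTop (𝓝 t)}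

end RobustWasserstein

end

/-! The triangle inequality bounds `|W(μ̂_n, μ_θ) - W(μ⋆, μ_θ)|` by `W(μ̂_n, μ⋆)`, which does not
depend on `θ`. So on the almost sure event of `hconv` the objectives converge uniformly on `Θ`, and
what remains is deterministic: uniform convergence of continuous objectives, with a compact sublevel
set of the limit, stabilises infima and minimizers (`argmin_stability`). Two facts about `W` are
needed. `robustDist_triangle` comes from gluing couplings. `tendsto_robustDist_of_tendsto`, which
makes `θ ↦ W(ν, μ_θ)` continuous, comes from matching mass inside the cells of a fine partition;
unmatched mass costs at most `2 * lam` per unit, so no moment condition enters. -/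

namespace RobustWasserstein

/-! ### Stability of infima and minimizers. -/

section Optimization

variable {T : Type*} {f g : T → ℝ} {δ : ℝ}

lemma iInf_sub_iInf_le [Nonempty T] (hf : BddBelow (Set.range f))
    (h : ∀ t, f t ≤ g t + δ) : (⨅ t, f t) - δ ≤ ⨅ t, g t :=
  le_ciInf fun t => by linarith [ciInf_le hf t, h t]

lemma abs_iInf_sub_iInf_le [Nonempty T] (hf : BddBelow (Set.range f))
    (hg : BddBelow (Set.range g)) (h : ∀ t, |g t - f t| ≤ δ) :
    |(⨅ t, g t) - ⨅ t, f t| ≤ δ := by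
  have h1 := iInf_sub_iInf_le (g := g) (δ := δ) hf fun t => by linarith [(abs_le.1 (h t)).1]
  have h2 := iInf_sub_iInf_le (g := f) (δ := δ) hg fun t => by linarith [(abs_le.1 (h t)).2]
  rw [abs_le]
  constructor <;> linarith

/-- One `δ` pays for passing from `f t` to `g t`, the other for comparing the infima. -/
lemma le_iInf_add_of_mem_argminSet [Nonempty T] (hf : BddBelow (Set.range f))
    (hg : BddBelow (Set.range g)) (h : ∀ t, |g t - f t| ≤ δ) {t : T} (ht : t ∈ argminSet g) :
    f t ≤ (⨅ s, f s) + 2 * δ := by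
  have h1 : g t ≤ ⨅ s, g s := le_ciInf ht
  have h2 := abs_le.1 (abs_iInf_sub_iInf_le hf hg h)
  linarith [(abs_le.1 (h t)).1]

/-- The minimum of `g` over the compact sublevel set of `f` is global: outside that set `g` exceeds
`inf f + ε - δ`, while a near-minimizer `s₀` of `f` inside it has `g s₀` below this value. -/
lemma argminSet_nonempty_of_abs_sub_le [TopologicalSpace T] [Nonempty T] {ε : ℝ}
    (hgc : Continuous g) (hε : 0 < ε)
    (hK : IsCompact {t | f t ≤ (⨅ s, f s) + ε})
    (h : ∀ t, |g t - f t| ≤ δ) (hδ : 2 * δ < ε) : (argminSet g).Nonempty := by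
  have hsub : 0 < min ε (ε - 2 * δ) := lt_min hε (by linarith)
  obtain ⟨s₀, hs₀⟩ := exists_lt_of_ciInf_lt (lt_add_of_pos_right (⨅ s, f s) hsub)
  have hs₁ : f s₀ < (⨅ s, f s) + ε := hs₀.trans_le (by gcongr; exact min_le_left _ _)
  have hs₂ : f s₀ < (⨅ s, f s) + (ε - 2 * δ) := hs₀.trans_le (by gcongr; exact min_le_right _ _)
  obtain ⟨t, -, ht⟩ := hK.exists_isMinOn ⟨s₀, hs₁.le⟩ hgc.continuousOn
  refine ⟨t, fun s => ?_⟩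
  by_cases hs : f s ≤ (⨅ s, f s) + ε
  · exact ht hs
  · have h1 : g t ≤ g s₀ := ht hs₁.le
    push Not at hs
    linarith [(abs_le.1 (h s)).1, (abs_le.1 (h s₀)).2]

/-- Stability of infima and minimizers under uniform convergence. -/
theorem argmin_stability {Θ : Type*} [MetricSpace Θ] [ProperSpace Θ] [Nonempty Θ]
    {F : ℕ → Θ → ℝ} {f : Θ → ℝ} {δ : ℕ → ℝ} {ε : ℝ}
    (hf : Continuous f) (hfb : BddBelow (Set.range f))
    (hF : ∀ᶠ n in atTop, Continuous (F n)) (hFb : ∀ n, BddBelow (Set.range (F n)))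
    (hδ : Tendsto δ atTop (𝓝 0)) (hFf : ∀ᶠ n in atTop, ∀ θ, |F n θ - f θ| ≤ δ n)
    (hε : 0 < ε) (hbdd : Bornology.IsBounded {θ | f θ ≤ (⨅ θ', f θ') + ε}) :
    Tendsto (fun n => ⨅ θ, F n θ) atTop (𝓝 (⨅ θ, f θ)) ∧
      (∃ N : ℕ, (∀ n, N ≤ n → (argminSet (F n)).Nonempty) ∧
        Bornology.IsBounded (⋃ n, ⋃ (_ : N ≤ n), argminSet (F n))) ∧
      outerLimit (fun n => argminSet (F n)) ⊆ argminSet f := by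
  have hK : IsCompact {θ | f θ ≤ (⨅ θ', f θ') + ε} :=
    Metric.isCompact_of_isClosed_isBounded (isClosed_le hf continuous_const) hbdd
  refine ⟨?_, ?_, ?_⟩
  · rw [tendsto_iff_dist_tendsto_zero]
    refine squeeze_zero' (Eventually.of_forall fun _ => dist_nonneg) ?_ hδ
    filter_upwards [hFf] with n hn
    exact abs_iInf_sub_iInf_le hfb (hFb n) hn
  · have hsmall : ∀ᶠ n in atTop, δ n < ε / 2 := hδ.eventually_lt_const (by linarith)
    obtain ⟨N, hN⟩ := eventually_atTop.1 (hF.and (hFf.and hsmall))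
    refine ⟨N, fun n hn => ?_, hbdd.subset ?_⟩
    · obtain ⟨h1, h2, h3⟩ := hN n hn
      exact argminSet_nonempty_of_abs_sub_le h1 hε hK h2 (by linarith)
    · refine Set.iUnion₂_subset fun n hn θ hθ => ?_
      obtain ⟨-, h2, h3⟩ := hN n hn
      have := le_iInf_add_of_mem_argminSet hfb (hFb n) h2 hθ
      show f θ ≤ _
      linarith
  · rintro θ ⟨φ, hφ, u, hu, huθ⟩ s
    have h1 : Tendsto (fun k => f (u k)) atTop (𝓝 (f θ)) := (hf.tendsto θ).comp huθ
    have h2 : Tendsto (fun k => (⨅ s, f s) + 2 * δ (φ k)) atTop (𝓝 ((⨅ s, f s) + 2 * 0)) :=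
      ((hδ.comp hφ.tendsto_atTop).const_mul 2).const_add _
    have h3 : f θ ≤ (⨅ s, f s) + 2 * 0 := by
      -- Each `u k` minimizes `f` up to `2 * δ (φ k)`, and this error vanishes in the limit.
      refine le_of_tendsto_of_tendsto h1 h2 ?_
      filter_upwards [hφ.tendsto_atTop.eventually hFf] with k hk
      exact le_iInf_add_of_mem_argminSet hfb (hFb _) hk (hu k)
    linarith [ciInf_le hfb s]

end Optimization

open scoped ProbabilityTheory

/-! ### Couplings and gluing. -/

section Couplings

variable {X : Type*} [MeasurableSpace X]

lemma prod_mem_couplings (μ ν : Measure X) [IsProbabilityMeasure μ] [IsProbabilityMeasure ν] :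
    μ.prod ν ∈ couplings μ ν :=
  ⟨Measure.fst_prod, Measure.snd_prod⟩

lemma isProbabilityMeasure_of_mem_couplings {μ ν : Measure X} [IsProbabilityMeasure μ]
    {π : Measure (X × X)} (hπ : π ∈ couplings μ ν) : IsProbabilityMeasure π :=
  ⟨by rw [← Measure.fst_univ, hπ.1, measure_univ]⟩

lemma swap_mem_couplings {μ ν : Measure X} {π : Measure (X × X)} (hπ : π ∈ couplings μ ν) :
    π.map Prod.swap ∈ couplings ν μ :=
  ⟨by simpa using hπ.2, by simpa using hπ.1⟩

/-- Gluing of two couplings along their common marginal. -/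
lemma exists_gluing [StandardBorelSpace X] {μ ν ρ : Measure X} [IsProbabilityMeasure ν]
    {π₁ π₂ : Measure (X × X)} (h₁ : π₁ ∈ couplings μ ν) (h₂ : π₂ ∈ couplings ν ρ) :
    ∃ Γ : Measure (X × X × X), Γ.map (fun w => (w.2.1, w.1)) = π₁ ∧
      Γ.map (fun w => (w.1, w.2.2)) = π₂ := by
  have : Nonempty X := ν.nonempty_of_neZero
  have h₁' := swap_mem_couplings h₁
  have := isProbabilityMeasure_of_mem_couplings h₁'
  have := isProbabilityMeasure_of_mem_couplings h₂
  -- Both couplings are disintegrated over the shared marginal `ν`, and the outer coordinates are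
  -- made conditionally independent. The shared coordinate comes first in `Γ`.
  set κ := (π₁.map Prod.swap).condKernel
  set η := π₂.condKernel
  have e₁ : ν ⊗ₘ κ = π₁.map Prod.swap := by
    conv_rhs => rw [← (π₁.map Prod.swap).disintegrate κ, h₁'.1]
  have e₂ : ν ⊗ₘ η = π₂ := by
    conv_rhs => rw [← π₂.disintegrate η, h₂.1]
  have hm₁ : (ν ⊗ₘ (κ ×ₖ η)).map (Prod.map id Prod.fst) = ν ⊗ₘ κ := by
    rw [← Measure.compProd_map measurable_fst, ← ProbabilityTheory.Kernel.fst_eq,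
      ProbabilityTheory.Kernel.fst_prod]
  have hm₂ : (ν ⊗ₘ (κ ×ₖ η)).map (Prod.map id Prod.snd) = ν ⊗ₘ η := by
    rw [← Measure.compProd_map measurable_snd, ← ProbabilityTheory.Kernel.snd_eq,
      ProbabilityTheory.Kernel.snd_prod]
  refine ⟨ν ⊗ₘ (κ ×ₖ η), ?_, ?_⟩
  · have : (fun w : X × X × X => (w.2.1, w.1)) = Prod.swap ∘ Prod.map id Prod.fst := rfl
    rw [this, ← Measure.map_map measurable_swap (by fun_prop), hm₁, e₁,
      Measure.map_map measurable_swap measurable_swap]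
    simp
  · exact hm₂.trans e₂

end Couplings

/-! ### Symmetry and triangle inequality of the robust distance. -/

section Metric

variable {X : Type*} [MetricSpace X] {lam : ℝ}

lemma trimmedDist_nonneg (hlam : 0 < lam) (x y : X) : 0 ≤ trimmedDist lam x y :=
  le_min dist_nonneg (by linarith)

lemma trimmedDist_comm (x y : X) : trimmedDist lam x y = trimmedDist lam y x := by
  simp [trimmedDist, dist_comm]

lemma trimmedDist_triangle (hlam : 0 < lam) (x y z : X) :
    trimmedDist lam x z ≤ trimmedDist lam x y + trimmedDist lam y z := by
  have h1 := trimmedDist_nonneg hlam x y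
  have h2 := trimmedDist_nonneg hlam y z
  have h3 := dist_triangle x y z
  unfold trimmedDist at *
  rcases min_cases (dist x y) (2 * lam) with h | h <;>
  rcases min_cases (dist y z) (2 * lam) with h' | h' <;>
  rcases min_cases (dist x z) (2 * lam) with h'' | h'' <;> linarith

variable [MeasurableSpace X]

lemma robustDist_nonneg (hlam : 0 < lam) (μ ν : Measure X) : 0 ≤ robustDist lam μ ν := by
  refine Real.sInf_nonneg ?_
  rintro _ ⟨π, -, rfl⟩
  exact integral_nonneg fun z => trimmedDist_nonneg hlam _ _

lemma robustDist_le_integral (hlam : 0 < lam) {μ ν : Measure X} {π : Measure (X × X)}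
    (hπ : π ∈ couplings μ ν) : robustDist lam μ ν ≤ ∫ z, trimmedDist lam z.1 z.2 ∂π := by
  refine csInf_le ⟨0, ?_⟩ ⟨π, hπ, rfl⟩
  rintro _ ⟨π, -, rfl⟩
  exact integral_nonneg fun z => trimmedDist_nonneg hlam _ _

lemma exists_coupling_lt (μ ν : Measure X) [IsProbabilityMeasure μ] [IsProbabilityMeasure ν]
    {r : ℝ} (hr : robustDist lam μ ν < r) :
    ∃ π ∈ couplings μ ν, ∫ z, trimmedDist lam z.1 z.2 ∂π < r := by
  obtain ⟨_, ⟨π, hπ, rfl⟩, h⟩ := exists_lt_of_csInf_lt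
    (Set.Nonempty.image _ ⟨_, prod_mem_couplings μ ν⟩) hr
  exact ⟨π, hπ, h⟩

variable [SecondCountableTopology X] [BorelSpace X]

lemma measurable_trimmedDist :
    Measurable fun z : X × X => trimmedDist lam z.1 z.2 :=
  measurable_dist.min measurable_const

lemma integrable_trimmedDist {α : Type*} [MeasurableSpace α] (hlam : 0 < lam) (π : Measure α)
    [IsFiniteMeasure π] {f g : α → X} (hf : Measurable f) (hg : Measurable g) :
    Integrable (fun z => trimmedDist lam (f z) (g z)) π := by
  refine Integrable.of_bound
    (measurable_trimmedDist.comp (hf.prodMk hg)).aestronglyMeasurable (2 * lam) ?_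
  refine Eventually.of_forall fun z => ?_
  rw [Real.norm_of_nonneg (trimmedDist_nonneg hlam _ _)]
  exact min_le_right _ _

lemma robustDist_comm (μ ν : Measure X) : robustDist lam μ ν = robustDist lam ν μ := by
  have key (μ ν : Measure X) :
      (fun π : Measure (X × X) => ∫ z, trimmedDist lam z.1 z.2 ∂π) '' couplings μ ν ⊆
        (fun π : Measure (X × X) => ∫ z, trimmedDist lam z.1 z.2 ∂π) '' couplings ν μ := by
    rintro _ ⟨π, hπ, rfl⟩
    refine ⟨_, swap_mem_couplings hπ, ?_⟩
    dsimp only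
    rw [integral_map measurable_swap.aemeasurable
      measurable_trimmedDist.aestronglyMeasurable]
    simp [trimmedDist_comm]
  exact congrArg sInf ((key μ ν).antisymm (key ν μ))

/-- Glue couplings that are optimal up to `ε / 2`, integrate the pointwise triangle inequality, and
forget the middle coordinate; optimal couplings need not be known to exist. -/
theorem robustDist_triangle [StandardBorelSpace X] (hlam : 0 < lam) (μ ν ρ : Measure X)
    [IsProbabilityMeasure μ] [IsProbabilityMeasure ν] [IsProbabilityMeasure ρ] :
    robustDist lam μ ρ ≤ robustDist lam μ ν + robustDist lam ν ρ := by
  refine le_of_forall_pos_le_add fun ε hε => ?_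
  obtain ⟨π₁, h₁, l₁⟩ := exists_coupling_lt μ ν
    (lt_add_of_pos_right (robustDist lam μ ν) (half_pos hε))
  obtain ⟨π₂, h₂, l₂⟩ := exists_coupling_lt ν ρ
    (lt_add_of_pos_right (robustDist lam ν ρ) (half_pos hε))
  obtain ⟨Γ, g₁, g₂⟩ := exists_gluing h₁ h₂
  have m₁ : Measurable fun w : X × X × X => (w.2.1, w.1) := by fun_prop
  have m₂ : Measurable fun w : X × X × X => (w.1, w.2.2) := by fun_prop
  have m₃ : Measurable fun w : X × X × X => (w.2.1, w.2.2) := by fun_prop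
  have := isProbabilityMeasure_of_mem_couplings h₁
  have : IsProbabilityMeasure Γ := by
    constructor
    rw [← Set.preimage_univ (f := fun w : X × X × X => (w.2.1, w.1)),
      ← Measure.map_apply m₁ MeasurableSet.univ, g₁, measure_univ]
  have h₃ : Γ.map (fun w => (w.2.1, w.2.2)) ∈ couplings μ ρ := by
    constructor
    · rw [← h₁.1, ← g₁, Measure.fst, Measure.fst, Measure.map_map measurable_fst m₃,
        Measure.map_map measurable_fst m₁]
      rfl
    · rw [← h₂.2, ← g₂, Measure.snd, Measure.snd, Measure.map_map measurable_snd m₃,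
        Measure.map_map measurable_snd m₂]
      rfl
  have hle := robustDist_le_integral hlam h₃
  rw [integral_map m₃.aemeasurable measurable_trimmedDist.aestronglyMeasurable] at hle
  rw [← g₁, integral_map m₁.aemeasurable measurable_trimmedDist.aestronglyMeasurable] at l₁
  rw [← g₂, integral_map m₂.aemeasurable measurable_trimmedDist.aestronglyMeasurable] at l₂
  have i₁ := integrable_trimmedDist hlam Γ (f := fun w => w.2.1) (g := fun w => w.1)
    (by fun_prop) (by fun_prop)
  have i₂ := integrable_trimmedDist hlam Γ (f := fun w => w.1) (g := fun w => w.2.2)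
    (by fun_prop) (by fun_prop)
  have i₃ := integrable_trimmedDist hlam Γ (f := fun w => w.2.1) (g := fun w => w.2.2)
    (by fun_prop) (by fun_prop)
  have := integral_mono i₃ (i₁.add i₂) fun w => trimmedDist_triangle hlam _ _ _
  simp only [Pi.add_apply] at this
  rw [integral_add i₁ i₂] at this
  linarith

/-- The bound is free of `ρ`: this is the source of both the uniformity in `θ` and the continuity in
`θ`. -/
lemma abs_robustDist_sub_le [StandardBorelSpace X] (hlam : 0 < lam) (μ ν ρ : Measure X)
    [IsProbabilityMeasure μ] [IsProbabilityMeasure ν] [IsProbabilityMeasure ρ] :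
    |robustDist lam μ ρ - robustDist lam ν ρ| ≤ robustDist lam μ ν := by
  have h1 := robustDist_triangle hlam μ ν ρ
  have h2 := robustDist_triangle hlam ν μ ρ
  rw [robustDist_comm ν μ] at h2
  rw [abs_le]
  constructor <;> linarith

end Metric

/-! ### Sub-couplings and their completion. -/

section SubCoupling

variable {X : Type*} [MeasurableSpace X]

/-- Completing a sub-coupling by a multiple of the product of the remaining marginals. -/
lemma exists_coupling_ge (μ ν : Measure X) [IsProbabilityMeasure μ] [IsProbabilityMeasure ν]
    (γ : Measure (X × X)) (h₁ : γ.fst ≤ μ) (h₂ : γ.snd ≤ ν) :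
    ∃ σ : Measure (X × X), γ + σ ∈ couplings μ ν := by
  have f₁ : IsFiniteMeasure γ.fst := isFiniteMeasure_of_le μ h₁
  have f₂ : IsFiniteMeasure γ.snd := isFiniteMeasure_of_le ν h₂
  have m₁ : (μ - γ.fst) Set.univ = 1 - γ Set.univ := by
    rw [Measure.sub_apply MeasurableSet.univ h₁, measure_univ, Measure.fst_univ]
  have m₂ : (ν - γ.snd) Set.univ = 1 - γ Set.univ := by
    rw [Measure.sub_apply MeasurableSet.univ h₂, measure_univ, Measure.snd_univ]
  -- The two remainders have equal mass, by which the marginals of their product are scaled. If this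
  -- mass is `0` the normalising factor is `⊤`, but the remainders vanish.
  have cancel (ρ : Measure X) (hρ : ρ Set.univ = 1 - γ Set.univ) :
      ((1 - γ Set.univ)⁻¹ * (1 - γ Set.univ)) • ρ = ρ := by
    rcases eq_or_ne (1 - γ Set.univ) 0 with h0 | h0
    · rw [h0, Measure.measure_univ_eq_zero] at hρ
      simp [hρ]
    · rw [ENNReal.inv_mul_cancel h0 (ENNReal.sub_ne_top ENNReal.one_ne_top), one_smul]
  refine ⟨(1 - γ Set.univ)⁻¹ • (μ - γ.fst).prod (ν - γ.snd), ?_, ?_⟩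
  · rw [Measure.fst, Measure.map_add _ _ measurable_fst, Measure.map_smul,
      Measure.map_fst_prod, m₂, smul_smul, cancel _ m₁, add_comm]
    exact Measure.sub_add_cancel_of_le h₁
  · rw [Measure.snd, Measure.map_add _ _ measurable_snd, Measure.map_smul,
      Measure.map_snd_prod, m₁, smul_smul, cancel _ m₂, add_comm]
    exact Measure.sub_add_cancel_of_le h₂

lemma sum_smul_restrict_le (μ : Measure X) {A : ℕ → Set X}
    (hA : ∀ i, MeasurableSet (A i))
    (hd : Pairwise (Function.onFun Disjoint A)) (s : Finset ℕ) {c : ℕ → ENNReal}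
    (hc : ∀ i, c i ≤ 1) : ∑ i ∈ s, c i • μ.restrict (A i) ≤ μ := by
  refine Measure.le_iff.2 fun t ht => ?_
  rw [Measure.finsetSum_apply]
  calc ∑ i ∈ s, (c i • μ.restrict (A i)) t ≤ ∑ i ∈ s, μ (t ∩ A i) := by
        refine Finset.sum_le_sum fun i _ => ?_
        rw [Measure.smul_apply, Measure.restrict_apply ht, smul_eq_mul]
        exact mul_le_of_le_one_left' (hc i)
    _ = μ (⋃ i ∈ s, t ∩ A i) := (measure_biUnion_finset
        (fun i _ j _ hij => ((hd hij).mono Set.inter_subset_right Set.inter_subset_right))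
        fun i _ => ht.inter (hA i)).symm
    _ ≤ μ t := measure_mono (Set.iUnion₂_subset fun i _ => Set.inter_subset_left)

end SubCoupling

/-! ### Weak convergence controls the robust distance. -/

section WeakConvergence

variable {X : Type*} [MetricSpace X] [MeasurableSpace X] [SecondCountableTopology X]
  [BorelSpace X] {lam : ℝ}

/-- The mass of `γ` costs at most `ε` per unit; the rest, coupled arbitrarily, costs at most `2 *
lam` per unit because the cost is trimmed. -/
lemma robustDist_le_of_subcoupling (hlam : 0 < lam) (μ ν : Measure X) [IsProbabilityMeasure μ]
    [IsProbabilityMeasure ν] (γ : Measure (X × X)) (h₁ : γ.fst ≤ μ) (h₂ : γ.snd ≤ ν) {ε : ℝ}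
    (hε : 0 ≤ ε) (hγ : ∀ᵐ z ∂γ, dist z.1 z.2 ≤ ε) :
    robustDist lam μ ν ≤ ε + 2 * lam * (1 - γ.real Set.univ) := by
  obtain ⟨σ, hσ⟩ := exists_coupling_ge μ ν γ h₁ h₂
  have hp := isProbabilityMeasure_of_mem_couplings hσ
  have : IsFiniteMeasure γ := isFiniteMeasure_of_le (γ + σ) (Measure.le_add_right le_rfl)
  have : IsFiniteMeasure σ := isFiniteMeasure_of_le (γ + σ) (Measure.le_add_left le_rfl)
  have hsum : γ.real Set.univ + σ.real Set.univ = 1 := by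
    rw [← measureReal_add_apply, probReal_univ]
  have iγ := integrable_trimmedDist hlam γ measurable_fst measurable_snd
  have iσ := integrable_trimmedDist hlam σ measurable_fst measurable_snd
  have b₁ : ∫ z, trimmedDist lam z.1 z.2 ∂γ ≤ γ.real Set.univ * ε := by
    have := integral_mono_ae iγ (integrable_const ε)
      (hγ.mono fun z hz => (min_le_left _ _).trans hz)
    simpa using this
  have b₂ : ∫ z, trimmedDist lam z.1 z.2 ∂σ ≤ σ.real Set.univ * (2 * lam) := by
    have := integral_mono iσ (integrable_const (2 * lam)) fun z => min_le_right _ _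
    simpa using this
  have hle := robustDist_le_integral hlam hσ
  rw [integral_add_measure iγ iσ] at hle
  have h1 : γ.real Set.univ ≤ 1 := by linarith [measureReal_nonneg (μ := σ) (s := Set.univ)]
  have h2 : γ.real Set.univ * ε ≤ ε := mul_le_of_le_one_left hε h1
  have h3 : σ.real Set.univ = 1 - γ.real Set.univ := by linarith
  rw [h3] at b₂
  linarith

/-- Within each cell the two measures can share the smaller of their masses, and matched points of
one cell are at distance at most `ε`. -/
lemma robustDist_le_of_partition (hlam : 0 < lam) (μ ν : Measure X) [IsProbabilityMeasure μ]
    [IsProbabilityMeasure ν] {A : ℕ → Set X} (hA : ∀ i, MeasurableSet (A i))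
    (hd : Pairwise (Function.onFun Disjoint A)) {ε : ℝ} (hε : 0 ≤ ε)
    (hdiam : ∀ i, ∀ x ∈ A i, ∀ y ∈ A i, dist x y ≤ ε) (s : Finset ℕ) :
    robustDist lam μ ν ≤
      ε + 2 * lam * (1 - ∑ i ∈ s, min (μ.real (A i)) (ν.real (A i))) := by
  -- Dividing the product of the restrictions, of mass `μ (A i) * ν (A i)`, by the maximum leaves
  -- the minimum. If both masses are `0` then `c i = ⊤` multiplies a zero measure.
  set c : ℕ → ENNReal := fun i => (max (μ (A i)) (ν (A i)))⁻¹
  set γ : Measure (X × X) := ∑ i ∈ s, c i • (μ.restrict (A i)).prod (ν.restrict (A i)) with hγ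
  have hfst : γ.fst = ∑ i ∈ s, (c i * ν (A i)) • μ.restrict (A i) := by
    ext t ht
    rw [Measure.fst_apply ht, hγ, Measure.finsetSum_apply, Measure.finsetSum_apply]
    refine Finset.sum_congr rfl fun i _ => ?_
    rw [← Set.prod_univ]
    simp only [Measure.smul_apply, Measure.prod_prod, Measure.restrict_apply_univ, smul_eq_mul]
    ring
  have hsnd : γ.snd = ∑ i ∈ s, (c i * μ (A i)) • ν.restrict (A i) := by
    ext t ht
    rw [Measure.snd_apply ht, hγ, Measure.finsetSum_apply, Measure.finsetSum_apply]
    refine Finset.sum_congr rfl fun i _ => ?_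
    rw [← Set.univ_prod]
    simp [mul_assoc]
  have hae : ∀ᵐ z ∂γ, dist z.1 z.2 ≤ ε := by
    rw [ae_iff, hγ, Measure.finsetSum_apply]
    refine Finset.sum_eq_zero fun i _ => ?_
    rw [Measure.prod_restrict, Measure.smul_apply, smul_eq_mul]
    refine mul_eq_zero_of_right _ (ae_iff.1 ?_)
    exact (ae_restrict_iff' ((hA i).prod (hA i))).2
      (Eventually.of_forall fun z hz => hdiam i _ hz.1 _ hz.2)
  have hmass : γ Set.univ = ∑ i ∈ s, min (μ (A i)) (ν (A i)) := by
    rw [← Measure.fst_univ, hfst, Measure.finsetSum_apply]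
    refine Finset.sum_congr rfl fun i _ => ?_
    rw [Measure.smul_apply, Measure.restrict_apply MeasurableSet.univ, Set.univ_inter,
      smul_eq_mul, mul_assoc, mul_comm (ν (A i)), ← min_mul_max (μ (A i))]
    rcases eq_or_ne (max (μ (A i)) (ν (A i))) 0 with h0 | h0
    · have : min (μ (A i)) (ν (A i)) = 0 := le_antisymm (h0 ▸ min_le_max) zero_le
      simp [this]
    · rw [mul_comm (min _ _), ← mul_assoc, ENNReal.inv_mul_cancel h0 (by simp), one_mul]
  have hreal : γ.real Set.univ = ∑ i ∈ s, min (μ.real (A i)) (ν.real (A i)) := by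
    rw [Measure.real, hmass, ENNReal.toReal_sum (by simp)]
    exact Finset.sum_congr rfl fun i _ =>
      ENNReal.toReal_min (measure_ne_top _ _) (measure_ne_top _ _)
  rw [← hreal]
  refine robustDist_le_of_subcoupling hlam μ ν γ ?_ ?_ hε hae
  · rw [hfst]
    refine sum_smul_restrict_le μ hA hd s fun i => ?_
    exact (mul_le_mul_right (le_max_right _ _) _).trans (ENNReal.inv_mul_le_one _)
  · rw [hsnd]
    refine sum_smul_restrict_le ν hA hd s fun i => ?_
    exact (mul_le_mul_right (le_max_left _ _) _).trans (ENNReal.inv_mul_le_one _)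

/-- A separable metric space has countable partitions into small continuity sets. -/
lemma exists_partition_null_frontier (μ : Measure X) [IsProbabilityMeasure μ] {ε : ℝ}
    (hε : 0 < ε) :
    ∃ A : ℕ → Set X, (∀ i, MeasurableSet (A i)) ∧ Pairwise (Function.onFun Disjoint A) ∧
      (⋃ i, A i) = Set.univ ∧ (∀ i, ∀ x ∈ A i, ∀ y ∈ A i, dist x y ≤ ε) ∧
      ∀ i, μ (frontier (A i)) = 0 := by
  have : Nonempty X := μ.nonempty_of_neZero
  -- Radii above `ε / 4` let the balls around a dense sequence cover the space; radii below `ε / 2`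
  -- keep distances within a ball below `ε`.
  choose r hr hr0 using fun x : X =>
    exists_null_frontier_thickening μ {x} (show ε / 4 < ε / 2 by linarith)
  set B : ℕ → Set X := fun i =>
    Metric.thickening (r (TopologicalSpace.denseSeq X i)) {TopologicalSpace.denseSeq X i}
  refine ⟨disjointed B, fun i => ?_, disjoint_disjointed B, ?_, fun i x hx y hy => ?_,
    fun i => ?_⟩
  · exact MeasurableSet.disjointed (fun j => Metric.isOpen_thickening.measurableSet) i
  · rw [iUnion_disjointed, Set.eq_univ_iff_forall]
    intro x
    obtain ⟨i, hi⟩ := (TopologicalSpace.denseRange_denseSeq X).exists_dist_lt x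
      (show 0 < ε / 4 by linarith)
    refine Set.mem_iUnion.2 ⟨i, ?_⟩
    simp only [B, Metric.thickening_singleton, Metric.mem_ball]
    exact hi.trans (hr _).1
  · have hx' := disjointed_subset B i hx
    have hy' := disjointed_subset B i hy
    simp only [B, Metric.thickening_singleton, Metric.mem_ball] at hx' hy'
    have := dist_triangle_right x y (TopologicalSpace.denseSeq X i)
    linarith [(hr (TopologicalSpace.denseSeq X i)).2]
  -- The disjointed cells arise by successive differences, and the frontier of a difference lies in
  -- the union of the two frontiers.
  · refine disjointedRec (p := fun t => μ (frontier t) = 0) (fun t j ht => ?_) (hr0 _)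
    refine measure_mono_null ?_ (measure_union_null ht (hr0 (TopologicalSpace.denseSeq X j)))
    rw [Set.sdiff_eq]
    refine (frontier_inter_subset _ _).trans ?_
    rw [frontier_compl]
    exact Set.union_subset_union Set.inter_subset_left Set.inter_subset_right

/-- Weak convergence implies convergence in the robust Wasserstein distance. -/
theorem tendsto_robustDist_of_tendsto (hlam : 0 < lam) {ν : ℕ → ProbabilityMeasure X}
    {μ : ProbabilityMeasure X} (h : Tendsto ν atTop (𝓝 μ)) :
    Tendsto (fun n => robustDist lam (μ : Measure X) (ν n : Measure X)) atTop (𝓝 0) := by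
  have key : ∀ ε > 0, ∀ᶠ n in atTop,
      robustDist lam (μ : Measure X) (ν n : Measure X) < ε + 2 * lam * ε := by
    intro ε hε
    obtain ⟨A, hA, hd, hU, hdiam, hfr⟩ :=
      exists_partition_null_frontier (μ : Measure X) hε
    have hsum : HasSum (fun i => (μ : Measure X).real (A i)) 1 := by
      have h1 : ∑' i, (μ : Measure X) (A i) = 1 := by
        rw [← measure_iUnion hd hA, hU, measure_univ]
      have h2 := ENNReal.hasSum_toReal (h1.trans_ne ENNReal.one_ne_top)
      rwa [← ENNReal.tsum_toReal_eq fun i => measure_ne_top _ _, h1, ENNReal.toReal_one] at h2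
    -- Finitely many cells carry more than `1 - ε` of the mass of `μ`. Their frontiers are null, so
    -- their `ν n`-masses converge and the sum of the minima passes `1 - ε` too.
    obtain ⟨s, hs⟩ := (hsum.eventually_const_lt (show 1 - ε < 1 by linarith)).exists
    have hlim : Tendsto (fun n => ∑ i ∈ s,
        min ((μ : Measure X).real (A i)) ((ν n : Measure X).real (A i))) atTop
        (𝓝 (∑ i ∈ s, (μ : Measure X).real (A i))) := by
      refine tendsto_finsetSum _ fun i _ => ?_
      have h1 := ProbabilityMeasure.tendsto_measure_of_null_frontier_of_tendsto' h (hfr i)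
      have h2 := (ENNReal.tendsto_toReal (measure_ne_top (μ : Measure X) (A i))).comp h1
      have h3 := (tendsto_const_nhds (x := (μ : Measure X).real (A i))).min h2
      rwa [Measure.real, min_self] at h3
    filter_upwards [hlim.eventually_const_lt hs] with n hn
    refine (robustDist_le_of_partition hlam _ _ hA hd hε.le hdiam s).trans_lt ?_
    have : 2 * lam * (1 - ∑ i ∈ s, min ((μ : Measure X).real (A i)) ((ν n : Measure X).real (A i)))
        < 2 * lam * ε := by
      refine mul_lt_mul_of_pos_left ?_ (by linarith)
      linarith
    linarith
  refine tendsto_order.2 ⟨fun a ha => Eventually.of_forall fun n =>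
    ha.trans_le (robustDist_nonneg hlam _ _), fun a ha => ?_⟩
  have hpos : 0 < 1 + 2 * lam := by linarith
  -- The value of `ε` that solves `ε + 2 * lam * ε = a`.
  filter_upwards [key (a / (1 + 2 * lam)) (by positivity)] with n hn
  refine hn.trans_eq ?_
  field_simp

theorem continuous_robustDist_comp [StandardBorelSpace X] (hlam : 0 < lam) {Θ : Type*}
    [MetricSpace Θ] {model : Θ → ProbabilityMeasure X} (hcont : Continuous model)
    (ν : Measure X) [IsProbabilityMeasure ν] :
    Continuous fun θ => robustDist lam ν (model θ : Measure X) := by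
  refine continuous_iff_seqContinuous.2 fun u θ hu => ?_
  have h := tendsto_robustDist_of_tendsto hlam ((hcont.tendsto θ).comp hu)
  refine tendsto_iff_dist_tendsto_zero.2 (squeeze_zero (fun _ => dist_nonneg) (fun n => ?_) h)
  have := abs_robustDist_sub_le hlam (model (u n) : Measure X) (model θ) ν
  rw [Real.dist_eq]
  simpa only [robustDist_comm, Function.comp_apply] using this

end WeakConvergence

lemma isProbabilityMeasure_empirical {Ω X : Type*} [MeasurableSpace X] (Z : ℕ → Ω → X) {n : ℕ}
    (hn : 1 ≤ n) (ω : Ω) : IsProbabilityMeasure (empirical Z n ω) := by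
  constructor
  simp only [empirical, Measure.smul_apply, Measure.finsetSum_apply, measure_univ]
  simpa using ENNReal.inv_mul_cancel (by exact_mod_cast (by omega : n ≠ 0))
    (ENNReal.natCast_ne_top n)

/-- The event itself need not be measurable, so the complement of a measurable hull of the
exceptional set is taken. -/
lemma exists_measurableSet_prob_one_of_ae {Ω : Type*} [MeasurableSpace Ω] {P : Measure Ω}
    [IsProbabilityMeasure P] {p : Ω → Prop} (h : ∀ᵐ ω ∂P, p ω) :
    ∃ A, MeasurableSet A ∧ P A = 1 ∧ ∀ ω ∈ A, p ω := by
  refine ⟨(toMeasurable P {ω | ¬p ω})ᶜ, (measurableSet_toMeasurable _ _).compl, ?_,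
    fun ω hω => by_contra fun hn => hω (subset_toMeasurable P _ hn)⟩
  rw [prob_compl_eq_one_iff (measurableSet_toMeasurable _ _), measure_toMeasurable]
  exact h

end RobustWasserstein

/-! ### Conclusion for empirical measures. -/

theorem theorem6
    {Ω : Type*} [MeasurableSpace Ω] (P : Measure Ω) [IsProbabilityMeasure P]
    {X : Type*} [MetricSpace X] [PolishSpace X] [MeasurableSpace X] [BorelSpace X]
    {Θ : Type*} [MetricSpace Θ] [ProperSpace Θ] [Nonempty Θ]
    (lam : ℝ) (hlam : 0 < lam)
    (Z : ℕ → Ω → X) (hZ : ∀ i, Measurable (Z i))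
    (μstar : ProbabilityMeasure X) (model : Θ → ProbabilityMeasure X)
    (hconv : ∀ᵐ ω ∂P, Tendsto
      (fun n => RobustWasserstein.robustDist lam (RobustWasserstein.empirical Z n ω)
        (μstar : Measure X)) atTop (𝓝 0))
    (hcont : ∀ (u : ℕ → Θ) (θ : Θ), Tendsto (fun n => dist (u n) θ) atTop (𝓝 0) →
      Tendsto (fun n => model (u n)) atTop (𝓝 (model θ)))
    (hbdd : ∃ ε : ℝ, 0 < ε ∧ Bornology.IsBounded
      {θ : Θ | RobustWasserstein.robustDist lam (μstar : Measure X) (model θ : Measure X) ≤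
        (⨅ θ' : Θ, RobustWasserstein.robustDist lam (μstar : Measure X)
          (model θ' : Measure X)) + ε}) :
    ∃ A : Set Ω, MeasurableSet A ∧ P A = 1 ∧ ∀ ω ∈ A,
      Tendsto
        (fun n => ⨅ θ : Θ, RobustWasserstein.robustDist lam
          (RobustWasserstein.empirical Z n ω) (model θ : Measure X))
        atTop
        (𝓝 (⨅ θ : Θ, RobustWasserstein.robustDist lam (μstar : Measure X)
          (model θ : Measure X))) ∧
      (∃ N : ℕ,
        (∀ n, N ≤ n → (RobustWasserstein.argminSet fun θ : Θ =>
          RobustWasserstein.robustDist lam (RobustWasserstein.empirical Z n ω)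
            (model θ : Measure X)).Nonempty) ∧
        Bornology.IsBounded (⋃ n, ⋃ (_ : N ≤ n), RobustWasserstein.argminSet fun θ : Θ =>
          RobustWasserstein.robustDist lam (RobustWasserstein.empirical Z n ω)
            (model θ : Measure X))) ∧
      RobustWasserstein.outerLimit (fun n => RobustWasserstein.argminSet fun θ : Θ =>
          RobustWasserstein.robustDist lam (RobustWasserstein.empirical Z n ω)
            (model θ : Measure X)) ⊆
        RobustWasserstein.argminSet fun θ : Θ =>
          RobustWasserstein.robustDist lam (μstar : Measure X) (model θ : Measure X) := by
  have hmodel : Continuous model := continuous_iff_seqContinuous.2 fun u θ hu =>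
    hcont u θ (tendsto_iff_dist_tendsto_zero.1 hu)
  obtain ⟨A, hA, hPA, hlim⟩ := RobustWasserstein.exists_measurableSet_prob_one_of_ae hconv
  obtain ⟨ε, hε, hb⟩ := hbdd
  have hbelow (ν : Measure X) : BddBelow (Set.range fun θ : Θ =>
      RobustWasserstein.robustDist lam ν (model θ : Measure X)) :=
    ⟨0, by rintro _ ⟨θ, rfl⟩; exact RobustWasserstein.robustDist_nonneg hlam _ _⟩
  refine ⟨A, hA, hPA, fun ω hω => RobustWasserstein.argmin_stability
    (RobustWasserstein.continuous_robustDist_comp hlam hmodel _) (hbelow _) ?_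
    (fun n => hbelow _) (hlim ω hω) ?_ hε hb⟩
  -- `empirical Z 0 ω` is the zero measure, so the probability estimates start at `n = 1`.
  · filter_upwards [eventually_ge_atTop 1] with n hn
    have := RobustWasserstein.isProbabilityMeasure_empirical Z hn ω
    exact RobustWasserstein.continuous_robustDist_comp hlam hmodel _
  · filter_upwards [eventually_ge_atTop 1] with n hn θ
    have := RobustWasserstein.isProbabilityMeasure_empirical Z hn ω
    exact RobustWasserstein.abs_robustDist_sub_le hlam _ _ _
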